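/- Let $\beta=(\beta_w)_{|w|\le 4}$ be a sequence of real numbers indexed by the words $w$ of length at most $4$ in two noncommuting letters $X,Y$, with $\beta_v=\beta_w$ whenever $v$ is a cyclic permutation of $w$, and $\beta_w=\beta_{w^*}$, where $w^*$ is the reverse of $w$. Assume that $\beta$ is normalized ($\beta_1=1$) and noncommutative ($\beta_{X^2Y^2}\ne\beta_{XYXY}$). Let $\mathcal M_2=(\beta_{U^*V})_{|U|,|V|\le 2}$ be its $7\times 7$ moment matrix, with rows and columns indexed by the words $1,X,Y,X^2,XY,YX,Y^2$, and write $\mathbb X^2,\mathbb{XY},\mathbb{YX},\mathbb Y^2$ for the columns indexed by $X^2,XY,YX,Y^2$. A representing measure of $\beta$ consists of finitely many pairs $(A_i,B_i)$ of real symmetric $t_i\times t_i$ matrices, $t_i\ge 1$ (the atoms, of size $t_i$), and densities $\lambda_i>0$ with $\sum_i\lambda_i=1$, such that $\beta_w=\sum_i\lambda_i\frac1{t_i}\operatorname{tr} w(A_i,B_i)$ for all $|w|\le 4$. Its type is $(m_1,\dots,m_r)$ if it has exactly $m_k$ atoms of size $k$ for $1\le k\le r$, none of size greater than $r$, and $m_r\neq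 0$. It is minimal if $\beta$ has no representing measure of a type $(m_1',\dots,m_{r'}')$ with $r'<r$, or with $r'=r$ and $m_k'<m_k$ at the largest $k$ for which $m_k'\ne m_k$. The sequence $\beta$ admits an nc measure if it has a minimal representing measure of a type $(m_1,\dots,m_r)$ with $r>1$. Two representing measures are orthogonally equivalent if, after renumbering the atoms, the densities agree and each atom $(A_i,B_i)$ of the first corresponds to an atom $(U_iA_iU_i^t,U_iB_iU_i^t)$ of the second with $U_i$ orthogonal. Theorem. Suppose that $\mathcal M_2$ has rank $5$ and satisfies the column relations $\mathbb{XY}+\mathbb{YX}=\mathbf 0$ and $\mathbb X^2=\mathbb Y^2$. Then $\beta$ admits an nc measure if and only if $\mathcal M_2$ is positive semidefinite and $\beta_X=\beta_Y=0$. In that case the minimal representing measure is unique up to orthogonal equivalence, and it is of type $(1,1)$. -/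

import Mathlib

namespace BQTMP

/-- The two noncommuting letters. -/
inductive Letter
  | X
  | Y

/-- Words in the letters `X, Y` of length at most `n`. A word is the list of its letters: the product
of words is `++`, the involution is `List.reverse`, the empty word is `[]`, and cyclic equivalence
is `List.IsRotated`, written `~r`. -/
abbrev Word (n : ℕ) : Type := {w : List Letter // w.length ≤ n}

/-- A real sequence `β = (β_w)`, indexed by the words of length at most `4`, that is invariant under
cyclic equivalence and under the involution. -/
structure TracialSeq where
  val : Word 4 → ℝ
  cyclic : ∀ v w : Word 4, v.1 ~r w.1 → val v = val w
  star : ∀ v w : Word 4, w.1 = v.1.reverse → val v = val w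

/-- The moment `β_w`. -/
def TracialSeq.moment (β : TracialSeq) (w : List Letter) (h : w.length ≤ 4 := by decide) : ℝ :=
  β.val ⟨w, h⟩

/-- `β` is normalized: `β_1 = 1`. -/
def TracialSeq.Normalized (β : TracialSeq) : Prop :=
  β.moment [] = 1

/-- `β` is a noncommutative sequence: `β_{X²Y²} ≠ β_{XYXY}`. -/
def TracialSeq.Noncommutative (β : TracialSeq) : Prop :=
  β.moment [.X, .X, .Y, .Y] ≠ β.moment [.X, .Y, .X, .Y]

/-- The words of length at most two, in degree-lexicographic order. -/
def basisWord : Fin 7 → Word 2 :=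
  ![⟨[], by decide⟩, ⟨[.X], by decide⟩, ⟨[.Y], by decide⟩, ⟨[.X, .X], by decide⟩,
    ⟨[.X, .Y], by decide⟩, ⟨[.Y, .X], by decide⟩, ⟨[.Y, .Y], by decide⟩]

/-- The word `u* v`. -/
def starMul (u v : Word 2) : Word 4 :=
  ⟨u.1.reverse ++ v.1, by
    have hu := u.2
    have hv := v.2
    simp only [List.length_append, List.length_reverse]
    omega⟩

/-- The truncated moment matrix `M₂(β)`: the entry in row `U` and column `V` is `β_{U* V}`. -/
def TracialSeq.momentMatrix (β : TracialSeq) : Matrix (Fin 7) (Fin 7) ℝ :=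
  Matrix.of fun i j => β.val (starMul (basisWord i) (basisWord j))

/-- The column of `M₂(β)` that is indexed by the word `w`. -/
def TracialSeq.column (β : TracialSeq) (w : List Letter) (h : w.length ≤ 2 := by decide) :
    Fin 7 → ℝ :=
  fun i => β.val (starMul (basisWord i) ⟨w, h⟩)

/-- An atom: a pair of real symmetric matrices of the same positive size. -/
structure Atom where
  size : ℕ
  size_pos : 0 < size
  A : Matrix (Fin size) (Fin size) ℝ
  B : Matrix (Fin size) (Fin size) ℝ
  A_symm : A.IsSymm
  B_symm : B.IsSymm

/-- The matrix substituted for a letter. -/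
def Atom.letter (a : Atom) : Letter → Matrix (Fin a.size) (Fin a.size) ℝ
  | .X => a.A
  | .Y => a.B

/-- The matrix `w(A, B)`. -/
def Atom.eval (a : Atom) (w : List Letter) : Matrix (Fin a.size) (Fin a.size) ℝ :=
  (w.map a.letter).prod

/-- The normalized trace of `w(A, B)`. -/
noncomputable def Atom.normTrace (a : Atom) (w : List Letter) : ℝ :=
  (a.eval w).trace / (a.size : ℝ)

/-- Two atoms are orthogonally equivalent if an orthogonal matrix conjugates one pair into the other.
(The two conditions on `U` force the sizes to agree.) -/
def Atom.OrthEquiv (a b : Atom) : Prop :=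
  ∃ U : Matrix (Fin b.size) (Fin a.size) ℝ,
    U.transpose * U = 1 ∧ U * U.transpose = 1 ∧
      b.A = U * a.A * U.transpose ∧ b.B = U * a.B * U.transpose

/-- Finitely many atoms with positive densities that sum to `1`. -/
structure AtomicMeasure where
  N : ℕ
  density : Fin N → ℝ
  density_pos : ∀ i, 0 < density i
  density_sum : ∑ i, density i = 1
  atom : Fin N → Atom

namespace AtomicMeasure

/-- `μ` represents `β`. -/
def Represents (μ : AtomicMeasure) (β : TracialSeq) : Prop :=
  ∀ w : Word 4, β.val w = ∑ i, μ.density i * (μ.atom i).normTrace w.1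

/-- The number of atoms of size `k`. -/
def numAtoms (μ : AtomicMeasure) (k : ℕ) : ℕ :=
  (Finset.univ.filter fun i => (μ.atom i).size = k).card

/-- The largest size of an atom. -/
def maxSize (μ : AtomicMeasure) : ℕ :=
  Finset.univ.sup fun i => (μ.atom i).size

/-- The type `(m₁, …, m_r)`: there are exactly `m_k` atoms of size `k`, and `r` is the largest size
of an atom. -/
def type (μ : AtomicMeasure) : List ℕ :=
  (List.range μ.maxSize).map fun k => μ.numAtoms (k + 1)

/-- The type of `μ` is strictly smaller than the type of `ν`: the largest size is smaller, or the
largest sizes agree and, at the largest size at which the numbers of atoms differ, `μ` has fewer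
atoms. -/
def Smaller (μ ν : AtomicMeasure) : Prop :=
  μ.maxSize < ν.maxSize ∨
    (μ.maxSize = ν.maxSize ∧ ∃ k, μ.numAtoms k < ν.numAtoms k ∧
      ∀ l, k < l → μ.numAtoms l = ν.numAtoms l)

/-- `μ` is a minimal representing measure of `β`. -/
def IsMinimal (μ : AtomicMeasure) (β : TracialSeq) : Prop :=
  μ.Represents β ∧ ¬ ∃ ν : AtomicMeasure, ν.Represents β ∧ ν.Smaller μ

/-- Orthogonal equivalence of measures: up to the enumeration of the atoms, the densities are equal
and the atoms are orthogonally equivalent. -/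
def OrthEquiv (μ ν : AtomicMeasure) : Prop :=
  ∃ e : Fin μ.N ≃ Fin ν.N, ∀ i,
    ν.density (e i) = μ.density i ∧ (μ.atom i).OrthEquiv (ν.atom (e i))

end AtomicMeasure

/-- `β` admits a noncommutative measure: it admits a minimal measure of type `(m₁, …, m_r)` with
`r > 1`. -/
def TracialSeq.AdmitsNcMeasure (β : TracialSeq) : Prop :=
  ∃ μ : AtomicMeasure, μ.IsMinimal β ∧ 1 < μ.maxSize

end BQTMP

/-!
If a measure represents `β` and `p` is a polynomial of degree at most two with coefficient vector
`x`, then `xᵀ M₂ x` is the sum of the nonnegative numbers `λᵢ tr(p(Aᵢ, Bᵢ)ᵀ p(Aᵢ, Bᵢ)) / tᵢ`.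
Hence `M₂` is positive semidefinite, and the column relations pass to each atom: `AB + BA = 0` and
`A² = B²`. These force `tr A = tr B = 0`, so `β_X = β_Y = 0`; the only atom of size one is
`(0, 0)`, and an atom of size two is either zero or orthogonally conjugate to `r` times a fixed
pair of reflections.

Conversely, the column relations and the cyclic symmetry express all moments through `β_1`, `β_X`,
`β_Y`, `β_{X²}` and `β_{X⁴}`. So, if `β_X = β_Y = 0`, the measure with atoms `(0, 0)` and
`r` times the reflections, the latter of density `l`, represents `β` as soon as `l r² = β_{X²}` and
`l r⁴ = β_{X⁴}`. When `M₂` is positive semidefinite of rank five, its kernel is spanned by the two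
relations, which gives `0 < β_{X²}` and `β_{X²}² < β_{X⁴}`; then there is a solution with
`0 < l < 1`, and `l` and `r²` are unique. The second inequality also excludes the types `(m)` and
`(0, 1)`, so that `(1, 1)` is minimal.
-/

namespace BQTMP

open Matrix

/-! ### Anticommuting matrices with equal squares -/

/-- The elements `a` and `b` satisfy the relations `ab + ba = 0` and `a² = b²`, which the column
relations of the theorem impose on the two matrices of an atom. -/
structure AnticommSqEq {R : Type*} [NonUnitalNonAssocRing R] (a b : R) : Prop where
  anticomm : a * b + b * a = 0
  sq_eq : a * a = b * b

theorem exists_mem_adjoin_pow_succ_mul_eq_pow (K : Type*) {R : Type*} [Field K] [Ring R]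
    [Algebra K R] [FiniteDimensional K R] (s : R) :
    ∃ k : ℕ, ∃ d ∈ Algebra.adjoin K {s}, s ^ (k + 1) * d = s ^ k := by
  have : IsArtinianRing (Algebra.adjoin K {s}) := IsArtinianRing.of_finite K _
  obtain ⟨k, d, hd⟩ := IsArtinian.exists_pow_succ_smul_dvd
    (⟨s, Algebra.self_mem_adjoin_singleton K s⟩ : Algebra.adjoin K {s})
    (1 : Algebra.adjoin K {s})
  exact ⟨k, d, d.2, by simpa using congrArg Subtype.val hd⟩

namespace AnticommSqEq

theorem zero (R : Type*) [NonUnitalNonAssocRing R] : AnticommSqEq (0 : R) 0 :=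
  ⟨by rw [mul_zero, add_zero], rfl⟩

theorem reflections {R : Type*} [CommRing R] (r : R) :
    AnticommSqEq !![r, 0; 0, -r] !![0, r; r, 0] where
  anticomm := by simp [← of_zero]
  sq_eq := by simp

theorem symm {R : Type*} [NonUnitalNonAssocRing R] {a b : R} (h : AnticommSqEq a b) :
    AnticommSqEq b a :=
  ⟨by rw [add_comm, h.anticomm], h.sq_eq.symm⟩

theorem mul_eq_neg_mul {R : Type*} [NonUnitalNonAssocRing R] {a b : R}
    (h : AnticommSqEq a b) : a * b = -(b * a) :=
  eq_neg_of_add_eq_zero_left h.anticomm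

/- Let `D` be a polynomial in `A² = B²` with `(A²)ᵏ⁺¹D = (A²)ᵏ`, and split `A = A²DA + A(1 - A²D)`:
the second summand is nilpotent, and anticommutativity gives `tr(A²DA) = tr(B²DA) = -tr(A²DA)`. -/
theorem trace_eq_zero {K n : Type*} [Field K] [NeZero (2 : K)] [Fintype n] {A B : Matrix n n K}
    (h : AnticommSqEq A B) : A.trace = 0 := by
  classical
  obtain ⟨k, D, hD, hk⟩ := exists_mem_adjoin_pow_succ_mul_eq_pow K (A * A)
  have hAD : Commute A D := Algebra.commute_of_mem_adjoin_singleton_of_commute hD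
    ((Commute.refl A).mul_right (.refl A))
  have hBD : Commute B D := Algebra.commute_of_mem_adjoin_singleton_of_commute hD
    (h.sq_eq ▸ (Commute.refl B).mul_right (.refl B))
  have hinvertible : (A * A * (D * A)).trace = 0 := by
    have hneg : (A * A * (D * A)).trace = -(A * A * (D * A)).trace := calc
      (A * A * (D * A)).trace = (B * (B * (D * A))).trace := by rw [h.sq_eq, mul_assoc]
      _ = (B * D * (A * B)).trace := by rw [trace_mul_comm]; simp only [mul_assoc]
      _ = -(B * (D * B) * A).trace := by
        rw [h.mul_eq_neg_mul, mul_neg, trace_neg]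
        simp only [mul_assoc]
      _ = -(A * A * (D * A)).trace := by rw [← hBD.eq, h.sq_eq]; simp only [mul_assoc]
    have htwo : (2 : K) * (A * A * (D * A)).trace = 0 := by linear_combination hneg
    exact (mul_eq_zero.1 htwo).resolve_left two_ne_zero
  have hnilpotent : IsNilpotent (A * (1 - A * A * D)) := by
    have hcomm : Commute A (1 - A * A * D) :=
      (Commute.one_right A).sub_right (((Commute.refl A).mul_right (.refl A)).mul_right hAD)
    have hkill : (A * A) ^ k * (1 - A * A * D) = 0 := by
      rw [mul_sub, mul_one, ← mul_assoc, ← pow_succ, hk, sub_self]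
    refine ⟨2 * k + 1, ?_⟩
    rw [hcomm.mul_pow, pow_succ' A, pow_succ' (1 - A * A * D), pow_mul, sq, mul_assoc,
      ← mul_assoc _ _ (_ ^ _), hkill, zero_mul, mul_zero]
  calc
    A.trace = (A * A * (D * A)).trace + (A * (1 - A * A * D)).trace := by
      rw [← trace_add, mul_sub, mul_one, ← hAD.eq]; simp only [mul_assoc, add_sub_cancel]
    _ = 0 := by
      rw [hinvertible, (isNilpotent_trace_of_isNilpotent hnilpotent).eq_zero, zero_add]

theorem exists_neg_eigenvector {n : Type*} [Fintype n] {A B : Matrix n n ℝ} (h : AnticommSqEq A B)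
    (hA : A.IsSymm) (hB : B.IsSymm) {r : ℝ} (hr : r ≠ 0) {v : n → ℝ} (hv : v ⬝ᵥ v = 1)
    (hAv : A *ᵥ v = r • v) :
    ∃ w, v ⬝ᵥ w = 0 ∧ w ⬝ᵥ w = 1 ∧ A *ᵥ w = -r • w ∧ B *ᵥ v = r • w ∧ B *ᵥ w = r • v := by
  have hself {M : Matrix n n ℝ} (hM : M.IsSymm) (x y : n → ℝ) : x ⬝ᵥ M *ᵥ y = M *ᵥ x ⬝ᵥ y := by
    rw [dotProduct_mulVec, ← mulVec_transpose, hM.eq]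
  obtain ⟨w, hBv⟩ : ∃ w, B *ᵥ v = r • w := ⟨r⁻¹ • B *ᵥ v, (smul_inv_smul₀ hr _).symm⟩
  have hAw : A *ᵥ w = -r • w := by
    apply smul_right_injective _ hr
    calc r • A *ᵥ w = (A * B) *ᵥ v := by rw [← mulVec_mulVec, hBv, mulVec_smul]
      _ = r • -r • w := by
        rw [h.mul_eq_neg_mul, neg_mulVec, ← mulVec_mulVec, hAv, mulVec_smul, hBv, neg_smul,
          smul_neg]
  have hBw : B *ᵥ w = r • v := by
    apply smul_right_injective _ hr
    calc r • B *ᵥ w = (B * B) *ᵥ v := by rw [← mulVec_mulVec, hBv, mulVec_smul]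
      _ = r • r • v := by rw [← h.sq_eq, ← mulVec_mulVec, hAv, mulVec_smul, hAv]
  refine ⟨w, ?_, ?_, hAw, hBv, hBw⟩
  · have := hself hA v w
    rw [hAv, hAw, dotProduct_smul, smul_dotProduct, smul_eq_mul, smul_eq_mul] at this
    have : r * (v ⬝ᵥ w) = 0 := by linarith
    exact (mul_eq_zero.1 this).resolve_left hr
  · have := hself hB v w
    rw [hBv, hBw, dotProduct_smul, smul_dotProduct, smul_eq_mul, smul_eq_mul, hv] at this
    exact (mul_left_cancel₀ hr this).symm

end AnticommSqEq

theorem mul_self_eq_neg_det_smul_one {R : Type*} [CommRing R] {A : Matrix (Fin 2) (Fin 2) R}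
    (hA : A.trace = 0) : A * A = (-A.det) • 1 := by
  rw [trace_fin_two, ← eq_neg_iff_add_eq_zero] at hA
  rw [A.eta_fin_two, hA, mul_fin_two, det_fin_two_of, one_fin_two, smul_of]
  ext i j
  fin_cases i <;> fin_cases j <;> simp [mul_comm, add_comm]

theorem exists_unit_eigenvector {A : Matrix (Fin 2) (Fin 2) ℝ} (hA : A.trace = 0) {r : ℝ}
    (hr : -A.det = r * r) : ∃ v, v ⬝ᵥ v = 1 ∧ A *ᵥ v = r • v := by
  have hdet : (A - r • 1).det = 0 := by
    rw [trace_fin_two] at hA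
    rw [det_fin_two] at hr ⊢
    simp only [Matrix.sub_apply, Matrix.smul_apply, one_apply_eq, smul_eq_mul, mul_one, mul_zero,
      one_apply_ne zero_ne_one, one_apply_ne one_ne_zero, sub_zero]
    linear_combination -hr - r * hA
  obtain ⟨x, hx, hAx⟩ := exists_mulVec_eq_zero_iff.2 hdet
  have hxx : 0 < x ⬝ᵥ x := dotProduct_self_star_pos_iff.2 hx
  refine ⟨(√(x ⬝ᵥ x))⁻¹ • x, ?_, ?_⟩
  · rw [dotProduct_smul, smul_dotProduct, smul_smul, smul_eq_mul, ← mul_inv,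
      Real.mul_self_sqrt hxx.le, inv_mul_cancel₀ hxx.ne']
  · rw [sub_mulVec, smul_mulVec, one_mulVec, sub_eq_zero] at hAx
    rw [mulVec_smul, hAx, smul_comm]

theorem AnticommSqEq.exists_orthogonal_conj {A B : Matrix (Fin 2) (Fin 2) ℝ}
    (h : AnticommSqEq A B) (hA : A.IsSymm) (hB : B.IsSymm) {r : ℝ} (hr : r ≠ 0)
    (hdet : -A.det = r * r) :
    ∃ U : Matrix (Fin 2) (Fin 2) ℝ, Uᵀ * U = 1 ∧ U * Uᵀ = 1 ∧
      A = U * !![r, 0; 0, -r] * Uᵀ ∧ B = U * !![0, r; r, 0] * Uᵀ := by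
  obtain ⟨v, hv, hAv⟩ := exists_unit_eigenvector h.trace_eq_zero hdet
  obtain ⟨w, hvw, hw, hAw, hBv, hBw⟩ := h.exists_neg_eigenvector hA hB hr hv hAv
  set U : Matrix (Fin 2) (Fin 2) ℝ := (of ![v, w])ᵀ with hU
  have hUU : Uᵀ * U = 1 := by
    ext i j
    fin_cases i <;> fin_cases j
    · simpa [hU, mul_apply, dotProduct] using hv
    · simpa [hU, mul_apply, dotProduct] using hvw
    · simpa [hU, mul_apply, dotProduct, mul_comm] using hvw
    · simpa [hU, mul_apply, dotProduct] using hw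
  have hUU' : U * Uᵀ = 1 := mul_eq_one_comm.1 hUU
  have hconj {M D : Matrix (Fin 2) (Fin 2) ℝ} (hMD : M * U = U * D) : M = U * D * Uᵀ := by
    rw [← hMD, mul_assoc, hUU', mul_one]
  refine ⟨U, hUU, hUU', hconj ?_, hconj ?_⟩
  · ext i j
    fin_cases j
    · simpa [hU, mul_apply, mulVec, dotProduct, mul_comm] using congrFun hAv i
    · simpa [hU, mul_apply, mulVec, dotProduct, mul_comm] using congrFun hAw i
  · ext i j
    fin_cases j
    · simpa [hU, mul_apply, mulVec, dotProduct, mul_comm] using congrFun hBv i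
    · simpa [hU, mul_apply, mulVec, dotProduct, mul_comm] using congrFun hBw i

/-! ### Moments of a sequence satisfying the column relations -/

/-- One representative of each class of words of length at most four under rotation, so that a
tracial sequence is determined by its values on this list. -/
def necklaces : List (List Letter) :=
  [[], [.X], [.Y], [.X, .X], [.X, .Y], [.Y, .Y], [.X, .X, .X], [.X, .X, .Y], [.X, .Y, .Y],
    [.Y, .Y, .Y], [.X, .X, .X, .X], [.X, .X, .X, .Y], [.X, .X, .Y, .Y], [.X, .Y, .X, .Y],
    [.X, .Y, .Y, .Y], [.Y, .Y, .Y, .Y]]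

instance : DecidableEq Letter
  | .X, .X => isTrue rfl
  | .X, .Y => isFalse nofun
  | .Y, .X => isFalse nofun
  | .Y, .Y => isTrue rfl

theorem exists_necklace_isRotated (w : List Letter) (hw : w.length ≤ 4) :
    ∃ v ∈ necklaces, v ~r w := by
  match w, hw with
  | [], _ => decide
  | [a], _ => cases a <;> decide
  | [a, b], _ => cases a <;> cases b <;> decide
  | [a, b, c], _ => cases a <;> cases b <;> cases c <;> decide
  | [a, b, c, d], _ => cases a <;> cases b <;> cases c <;> cases d <;> decide

namespace TracialSeq

/-- The column relations `XY + YX = 0` and `X² = Y²` of the moment matrix of `β`. -/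
structure ColumnRelations (β : TracialSeq) : Prop where
  anticomm : β.column [.X, .Y] + β.column [.Y, .X] = 0
  sq_eq : β.column [.X, .X] = β.column [.Y, .Y]

namespace ColumnRelations

variable {β γ : TracialSeq}

theorem quadratic_moments (h : β.ColumnRelations) :
    β.moment [.X, .Y] = 0 ∧ β.moment [.Y, .Y] = β.moment [.X, .X] := by
  have anticomm : β.moment [.X, .Y] + β.moment [.Y, .X] = 0 := congrFun h.anticomm 0
  have sq_eq : β.moment [.X, .X] = β.moment [.Y, .Y] := congrFun h.sq_eq 0
  have rotate_YX : β.moment [.Y, .X] = β.moment [.X, .Y] := β.cyclic _ _ ⟨1, rfl⟩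
  exact ⟨by linarith, sq_eq.symm⟩

theorem cubic_moments (h : β.ColumnRelations) :
    β.moment [.X, .X, .X] = 0 ∧ β.moment [.X, .X, .Y] = 0 ∧ β.moment [.X, .Y, .Y] = 0 ∧
      β.moment [.Y, .Y, .Y] = 0 := by
  have anticomm_X : β.moment [.X, .X, .Y] + β.moment [.X, .Y, .X] = 0 := congrFun h.anticomm 1
  have anticomm_Y : β.moment [.Y, .X, .Y] + β.moment [.Y, .Y, .X] = 0 := congrFun h.anticomm 2
  have sq_eq_X : β.moment [.X, .X, .X] = β.moment [.X, .Y, .Y] := congrFun h.sq_eq 1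
  have sq_eq_Y : β.moment [.Y, .X, .X] = β.moment [.Y, .Y, .Y] := congrFun h.sq_eq 2
  have rotate_XYX : β.moment [.X, .Y, .X] = β.moment [.X, .X, .Y] := β.cyclic _ _ ⟨2, rfl⟩
  have rotate_YXX : β.moment [.Y, .X, .X] = β.moment [.X, .X, .Y] := β.cyclic _ _ ⟨1, rfl⟩
  have rotate_YXY : β.moment [.Y, .X, .Y] = β.moment [.X, .Y, .Y] := β.cyclic _ _ ⟨1, rfl⟩
  have rotate_YYX : β.moment [.Y, .Y, .X] = β.moment [.X, .Y, .Y] := β.cyclic _ _ ⟨2, rfl⟩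
  refine ⟨?_, ?_, ?_, ?_⟩ <;> linarith

theorem quartic_moments (h : β.ColumnRelations) :
    β.moment [.X, .X, .X, .Y] = 0 ∧ β.moment [.X, .X, .Y, .Y] = β.moment [.X, .X, .X, .X] ∧
      β.moment [.X, .Y, .X, .Y] = -β.moment [.X, .X, .X, .X] ∧ β.moment [.X, .Y, .Y, .Y] = 0 ∧
      β.moment [.Y, .Y, .Y, .Y] = β.moment [.X, .X, .X, .X] := by
  have anticomm_XX : β.moment [.X, .X, .X, .Y] + β.moment [.X, .X, .Y, .X] = 0 :=
    congrFun h.anticomm 3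
  have anticomm_YX : β.moment [.Y, .X, .X, .Y] + β.moment [.Y, .X, .Y, .X] = 0 :=
    congrFun h.anticomm 4
  have anticomm_YY : β.moment [.Y, .Y, .X, .Y] + β.moment [.Y, .Y, .Y, .X] = 0 :=
    congrFun h.anticomm 6
  have sq_eq_XX : β.moment [.X, .X, .X, .X] = β.moment [.X, .X, .Y, .Y] := congrFun h.sq_eq 3
  have sq_eq_YY : β.moment [.Y, .Y, .X, .X] = β.moment [.Y, .Y, .Y, .Y] := congrFun h.sq_eq 6
  have rotate_XXYX : β.moment [.X, .X, .Y, .X] = β.moment [.X, .X, .X, .Y] :=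
    β.cyclic _ _ ⟨3, rfl⟩
  have rotate_YXXY : β.moment [.Y, .X, .X, .Y] = β.moment [.X, .X, .Y, .Y] :=
    β.cyclic _ _ ⟨1, rfl⟩
  have rotate_YXYX : β.moment [.Y, .X, .Y, .X] = β.moment [.X, .Y, .X, .Y] :=
    β.cyclic _ _ ⟨1, rfl⟩
  have rotate_YYXX : β.moment [.Y, .Y, .X, .X] = β.moment [.X, .X, .Y, .Y] :=
    β.cyclic _ _ ⟨2, rfl⟩
  have rotate_YYXY : β.moment [.Y, .Y, .X, .Y] = β.moment [.X, .Y, .Y, .Y] :=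
    β.cyclic _ _ ⟨2, rfl⟩
  have rotate_YYYX : β.moment [.Y, .Y, .Y, .X] = β.moment [.X, .Y, .Y, .Y] :=
    β.cyclic _ _ ⟨3, rfl⟩
  refine ⟨?_, ?_, ?_, ?_, ?_⟩ <;> linarith

theorem val_eq_val (hβ : β.ColumnRelations) (hγ : γ.ColumnRelations)
    (h_one : β.moment [] = γ.moment []) (hX : β.moment [.X] = γ.moment [.X])
    (hY : β.moment [.Y] = γ.moment [.Y]) (hXX : β.moment [.X, .X] = γ.moment [.X, .X])
    (hXXXX : β.moment [.X, .X, .X, .X] = γ.moment [.X, .X, .X, .X]) (w : Word 4) :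
    β.val w = γ.val w := by
  obtain ⟨bXY, bYY⟩ := hβ.quadratic_moments
  obtain ⟨gXY, gYY⟩ := hγ.quadratic_moments
  obtain ⟨bXXX, bXXY, bXYY, bYYY⟩ := hβ.cubic_moments
  obtain ⟨gXXX, gXXY, gXYY, gYYY⟩ := hγ.cubic_moments
  obtain ⟨bXXXY, bXXYY, bXYXY, bXYYY, bYYYY⟩ := hβ.quartic_moments
  obtain ⟨gXXXY, gXXYY, gXYXY, gXYYY, gYYYY⟩ := hγ.quartic_moments
  obtain ⟨v, hv, hvw⟩ := exists_necklace_isRotated w.1 w.2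
  have hv4 : v.length ≤ 4 := hvw.perm.length_eq.trans_le w.2
  rw [← β.cyclic ⟨v, hv4⟩ w hvw, ← γ.cyclic ⟨v, hv4⟩ w hvw]
  change β.moment v hv4 = γ.moment v hv4
  simp only [necklaces, List.mem_cons, List.not_mem_nil, or_false] at hv
  rcases hv with rfl | rfl | rfl | rfl | rfl | rfl | rfl | rfl | rfl | rfl | rfl | rfl | rfl | rfl |
    rfl | rfl <;> linarith

end ColumnRelations

end TracialSeq

/-- The coefficients of the polynomial `XY + YX` in the basis `basisWord`. -/
def anticommCoeff : Fin 7 → ℝ := Pi.single 4 1 + Pi.single 5 1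

/-- The coefficients of the polynomial `X² - Y²` in the basis `basisWord`. -/
def sqDiffCoeff : Fin 7 → ℝ := Pi.single 3 1 - Pi.single 6 1

namespace TracialSeq

variable {β : TracialSeq}

theorem ColumnRelations.mulVec_anticommCoeff (h : β.ColumnRelations) :
    β.momentMatrix *ᵥ anticommCoeff = 0 := by
  rw [anticommCoeff, mulVec_add, mulVec_single_one, mulVec_single_one]
  exact h.anticomm

theorem ColumnRelations.mulVec_sqDiffCoeff (h : β.ColumnRelations) :
    β.momentMatrix *ᵥ sqDiffCoeff = 0 := by
  rw [sqDiffCoeff, mulVec_sub, mulVec_single_one, mulVec_single_one]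
  exact sub_eq_zero.2 h.sq_eq

theorem ColumnRelations.ker_momentMatrix (h : β.ColumnRelations)
    (hrank : β.momentMatrix.rank = 5) :
    LinearMap.ker β.momentMatrix.mulVecLin = Submodule.span ℝ {anticommCoeff, sqDiffCoeff} := by
  have hker : Module.finrank ℝ (LinearMap.ker β.momentMatrix.mulVecLin) = 2 := by
    have hsum := β.momentMatrix.mulVecLin.finrank_range_add_finrank_ker
    rw [← Matrix.rank, hrank, Module.finrank_fin_fun] at hsum
    omega
  have hindep : LinearIndependent ℝ ![anticommCoeff, sqDiffCoeff] := by
    refine LinearIndependent.pair_iff.2 fun s t hst => ⟨?_, ?_⟩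
    · simpa [anticommCoeff, sqDiffCoeff] using congrFun hst 4
    · simpa [anticommCoeff, sqDiffCoeff] using congrFun hst 3
  have hspan := finrank_span_eq_card hindep
  rw [Matrix.range_cons_cons_empty, Fintype.card_fin] at hspan
  refine (Submodule.eq_of_le_of_finrank_eq (Submodule.span_le.2 ?_) (hspan.trans hker.symm)).symm
  rintro x (rfl | rfl)
  exacts [h.mulVec_anticommCoeff, h.mulVec_sqDiffCoeff]

theorem ColumnRelations.dotProduct_mulVec_pos (h : β.ColumnRelations)
    (hrank : β.momentMatrix.rank = 5) (hpsd : β.momentMatrix.PosSemidef) {x : Fin 7 → ℝ}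
    (hx : x ∉ Submodule.span ℝ {anticommCoeff, sqDiffCoeff}) :
    0 < x ⬝ᵥ β.momentMatrix *ᵥ x := by
  refine (hpsd.dotProduct_mulVec_nonneg x).lt_of_ne fun hzero => hx ?_
  rw [← h.ker_momentMatrix hrank]
  exact (hpsd.dotProduct_mulVec_zero_iff x).1 hzero.symm

theorem ColumnRelations.moment_XX_pos (h : β.ColumnRelations)
    (hrank : β.momentMatrix.rank = 5) (hpsd : β.momentMatrix.PosSemidef) :
    0 < β.moment [.X, .X] := by
  have hpos := h.dotProduct_mulVec_pos hrank hpsd (x := Pi.single 1 1) fun hmem => by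
    obtain ⟨s, t, hst⟩ := Submodule.mem_span_pair.1 hmem
    simpa [anticommCoeff, sqDiffCoeff] using congrFun hst 1
  rwa [mulVec_single_one, single_one_dotProduct] at hpos

theorem ColumnRelations.sq_moment_XX_lt (h : β.ColumnRelations) (hnorm : β.Normalized)
    (hrank : β.momentMatrix.rank = 5) (hpsd : β.momentMatrix.PosSemidef) :
    β.moment [.X, .X] ^ 2 < β.moment [.X, .X, .X, .X] := by
  set a := β.moment [.X, .X]
  have hpos := h.dotProduct_mulVec_pos hrank hpsd (x := Pi.single 3 1 - Pi.single 0 a)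
    fun hmem => by
      obtain ⟨s, t, hst⟩ := Submodule.mem_span_pair.1 hmem
      have h3 : t = 1 := by simpa [anticommCoeff, sqDiffCoeff] using congrFun hst 3
      have h6 : t = 0 := by simpa [anticommCoeff, sqDiffCoeff] using congrFun hst 6
      exact one_ne_zero (h3.symm.trans h6)
  have h00 : β.momentMatrix 0 0 = 1 := hnorm
  have h03 : β.momentMatrix 0 3 = a := rfl
  have h30 : β.momentMatrix 3 0 = a := rfl
  have h33 : β.momentMatrix 3 3 = β.moment [.X, .X, .X, .X] := rfl
  have hform : (Pi.single 3 1 - Pi.single 0 a) ⬝ᵥ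
      β.momentMatrix *ᵥ (Pi.single 3 1 - Pi.single 0 a) = β.moment [.X, .X, .X, .X] - a ^ 2 := by
    simp [mulVec_sub, sub_dotProduct, dotProduct_sub, h00, h03, h30, h33, sq]
  linarith

theorem isHermitian_momentMatrix (β : TracialSeq) : β.momentMatrix.IsHermitian := by
  ext i j
  exact β.star _ _ (by simp [starMul])

end TracialSeq

/-! ### Atoms of a representing measure -/

namespace Atom

theorem eval_append (a : Atom) (u v : List Letter) : a.eval (u ++ v) = a.eval u * a.eval v := by
  simp [eval]

theorem eval_cons (a : Atom) (l : Letter) (w : List Letter) :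
    a.eval (l :: w) = a.letter l * a.eval w := by
  simp [eval]

theorem transpose_letter (a : Atom) (l : Letter) : (a.letter l)ᵀ = a.letter l := by
  cases l
  exacts [a.A_symm, a.B_symm]

theorem eval_reverse (a : Atom) (w : List Letter) : a.eval w.reverse = (a.eval w)ᵀ := by
  rw [eval, eval, transpose_list_prod, List.map_map, List.map_reverse]
  congr 3
  exact funext fun l => (a.transpose_letter l).symm

theorem eval_pair (a : Atom) (l m : Letter) : a.eval [l, m] = a.letter l * a.letter m := by
  simp [eval]

theorem normTrace_eq_of_isRotated (a : Atom) {v w : List Letter} (h : v ~r w) :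
    a.normTrace v = a.normTrace w := by
  obtain ⟨n, rfl⟩ := h
  rw [normTrace, normTrace, List.rotate_eq_drop_append_take_mod, eval_append, trace_mul_comm,
    ← eval_append, List.take_append_drop]

theorem normTrace_nil (a : Atom) : a.normTrace [] = 1 := by
  have hsize : (a.size : ℝ) ≠ 0 := Nat.cast_ne_zero.2 a.size_pos.ne'
  simp [normTrace, eval, hsize]

theorem normTrace_reverse (a : Atom) (w : List Letter) :
    a.normTrace w.reverse = a.normTrace w := by
  rw [normTrace, normTrace, eval_reverse, trace_transpose]

/-- The value at an atom of the polynomial of degree at most two whose coefficients in the basis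
`basisWord` are the given ones. -/
def evalPoly (a : Atom) : (Fin 7 → ℝ) →ₗ[ℝ] Matrix (Fin a.size) (Fin a.size) ℝ :=
  Fintype.linearCombination ℝ fun j => a.eval (basisWord j).1

theorem evalPoly_anticommCoeff (a : Atom) :
    a.evalPoly anticommCoeff = a.A * a.B + a.B * a.A := by
  simp [evalPoly, anticommCoeff, Fintype.linearCombination_apply_single, basisWord, eval_pair,
    letter]

theorem evalPoly_sqDiffCoeff (a : Atom) :
    a.evalPoly sqDiffCoeff = a.A * a.A - a.B * a.B := by
  simp [evalPoly, sqDiffCoeff, Fintype.linearCombination_apply_single, basisWord, eval_pair,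
    letter]

theorem trace_conjTranspose_evalPoly_mul_self (a : Atom) (x : Fin 7 → ℝ) :
    ((a.evalPoly x)ᴴ * a.evalPoly x).trace / a.size =
      ∑ j, ∑ k, x j * (x k * a.normTrace (starMul (basisWord j) (basisWord k)).1) := by
  simp only [evalPoly, Fintype.linearCombination_apply, normTrace, starMul, eval_append,
    eval_reverse, conjTranspose_eq_transpose_of_trivial, transpose_sum, transpose_smul,
    Finset.sum_mul, Finset.mul_sum, trace_sum, smul_mul, Matrix.mul_smul, trace_smul, smul_eq_mul,
    Finset.sum_div, mul_div_assoc]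
  rw [Finset.sum_comm]
  exact Finset.sum_congr rfl fun j _ => Finset.sum_congr rfl fun k _ => mul_left_comm _ _ _

end Atom

namespace AtomicMeasure

/-- The moments of `μ` up to degree four, so that `μ` represents `β` if and only if `β` and
`μ.momentSeq` have the same values. -/
noncomputable def momentSeq (μ : AtomicMeasure) : TracialSeq where
  val w := ∑ i, μ.density i * (μ.atom i).normTrace w.1
  cyclic v w h := by simp only [Atom.normTrace_eq_of_isRotated _ h]
  star v w h := by simp only [h, Atom.normTrace_reverse]

theorem columnRelations_momentSeq {μ : AtomicMeasure}
    (h : ∀ i, AnticommSqEq (μ.atom i).A (μ.atom i).B) : μ.momentSeq.ColumnRelations where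
  anticomm := by
    funext j
    simp only [Pi.add_apply, TracialSeq.column, momentSeq]
    refine Finset.sum_add_distrib.symm.trans (Finset.sum_eq_zero fun i _ => ?_)
    simp only [starMul, Atom.normTrace, Atom.eval_append, Atom.eval_pair, Atom.letter]
    rw [← mul_add, ← add_div, ← trace_add, ← mul_add, (h i).anticomm, mul_zero, trace_zero,
      zero_div, mul_zero]
  sq_eq := by
    funext j
    simp only [TracialSeq.column, momentSeq]
    refine Finset.sum_congr rfl fun i _ => ?_
    simp only [starMul, Atom.normTrace, Atom.eval_append, Atom.eval_pair, Atom.letter,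
      (h i).sq_eq]

theorem density_mul_trace_nonneg (μ : AtomicMeasure) (x : Fin 7 → ℝ) (i : Fin μ.N) :
    0 ≤ μ.density i *
      ((((μ.atom i).evalPoly x)ᴴ * (μ.atom i).evalPoly x).trace / (μ.atom i).size) :=
  mul_nonneg (μ.density_pos i).le
    (div_nonneg (posSemidef_conjTranspose_mul_self _).trace_nonneg (Nat.cast_nonneg _))

namespace Represents

variable {μ : AtomicMeasure} {β : TracialSeq}

theorem dotProduct_momentMatrix_mulVec (h : μ.Represents β) (x : Fin 7 → ℝ) :
    x ⬝ᵥ β.momentMatrix *ᵥ x = ∑ i, μ.density i *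
      ((((μ.atom i).evalPoly x)ᴴ * (μ.atom i).evalPoly x).trace / (μ.atom i).size) := by
  simp only [Atom.trace_conjTranspose_evalPoly_mul_self, dotProduct, mulVec,
    TracialSeq.momentMatrix, of_apply, h _, Finset.mul_sum, Finset.sum_mul]
  rw [Finset.sum_comm (s := (Finset.univ : Finset (Fin μ.N)))]
  refine Finset.sum_congr rfl fun j _ => ?_
  rw [Finset.sum_comm (s := (Finset.univ : Finset (Fin μ.N)))]
  exact Finset.sum_congr rfl fun k _ => Finset.sum_congr rfl fun i _ => by ring

theorem posSemidef (h : μ.Represents β) : β.momentMatrix.PosSemidef := by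
  refine PosSemidef.of_dotProduct_mulVec_nonneg β.isHermitian_momentMatrix fun x => ?_
  rw [star_trivial, h.dotProduct_momentMatrix_mulVec]
  exact Finset.sum_nonneg fun i _ => μ.density_mul_trace_nonneg x i

theorem evalPoly_eq_zero (h : μ.Represents β) {x : Fin 7 → ℝ}
    (hx : β.momentMatrix *ᵥ x = 0) (i : Fin μ.N) : (μ.atom i).evalPoly x = 0 := by
  have hform := h.dotProduct_momentMatrix_mulVec x
  rw [hx, dotProduct_zero, eq_comm,
    Finset.sum_eq_zero_iff_of_nonneg fun i _ => μ.density_mul_trace_nonneg x i] at hform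
  have htrace := (mul_eq_zero.1 (hform i (Finset.mem_univ i))).resolve_left (μ.density_pos i).ne'
  exact trace_conjTranspose_mul_self_eq_zero_iff.1 <|
    (div_eq_zero_iff.1 htrace).resolve_right (Nat.cast_ne_zero.2 (μ.atom i).size_pos.ne')

theorem anticommSqEq (h : μ.Represents β) (hβ : β.ColumnRelations) (i : Fin μ.N) :
    AnticommSqEq (μ.atom i).A (μ.atom i).B where
  anticomm := by
    rw [← Atom.evalPoly_anticommCoeff, h.evalPoly_eq_zero hβ.mulVec_anticommCoeff]
  sq_eq := by
    rw [← sub_eq_zero, ← Atom.evalPoly_sqDiffCoeff, h.evalPoly_eq_zero hβ.mulVec_sqDiffCoeff]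

theorem moment_singleton_eq_zero (h : μ.Represents β) (hβ : β.ColumnRelations) (l : Letter) :
    β.moment [l] (by simp) = 0 := by
  refine (h _).trans (Finset.sum_eq_zero fun i _ => ?_)
  have htrace : ((μ.atom i).letter l).trace = 0 := by
    cases l
    exacts [(h.anticommSqEq hβ i).trace_eq_zero, (h.anticommSqEq hβ i).symm.trace_eq_zero]
  rw [Atom.normTrace, Atom.eval, List.map_singleton, List.prod_singleton, htrace, zero_div,
    mul_zero]

end Represents

end AtomicMeasure

namespace Atom

/-- The atom `(0, 0)` of size one, the only one whose matrices satisfy `AnticommSqEq`. -/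
def zero : Atom := ⟨1, one_pos, 0, 0, isSymm_zero, isSymm_zero⟩

/-- The atom of size two formed by `r` times two reflections whose axes meet at the angle
`π / 4`: the normal form, up to orthogonal equivalence, of the nonzero atoms of size two whose
matrices satisfy `AnticommSqEq`. -/
def reflections (r : ℝ) : Atom where
  size := 2
  size_pos := two_pos
  A := !![r, 0; 0, -r]
  B := !![0, r; r, 0]
  A_symm := by ext i j; fin_cases i <;> fin_cases j <;> rfl
  B_symm := by ext i j; fin_cases i <;> fin_cases j <;> rfl

theorem letter_zero (l : Letter) : zero.letter l = 0 := by
  cases l <;> rfl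

theorem normTrace_zero_cons (l : Letter) (w : List Letter) : zero.normTrace (l :: w) = 0 := by
  rw [normTrace, eval_cons, letter_zero, zero_mul, trace_zero, zero_div]

variable {a : Atom}

theorem normTrace_of_mul_self_eq_smul_one {s : ℝ} (h : a.A * a.A = s • 1) :
    a.normTrace [.X, .X] = s ∧ a.normTrace [.X, .X, .X, .X] = s ^ 2 := by
  have hsize : (a.size : ℝ) ≠ 0 := Nat.cast_ne_zero.2 a.size_pos.ne'
  have hXX : a.eval [.X, .X] = s • 1 := (a.eval_pair .X .X).trans h
  have hXXXX : a.eval [.X, .X, .X, .X] = s ^ 2 • 1 := by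
    refine (a.eval_append [.X, .X] [.X, .X]).trans ?_
    rw [hXX, smul_mul_smul_comm, mul_one, sq]
  rw [normTrace, normTrace, hXX, hXXXX, trace_smul, trace_smul, trace_one, Fintype.card_fin,
    smul_eq_mul, smul_eq_mul, mul_div_cancel_right₀ _ hsize, mul_div_cancel_right₀ _ hsize]
  exact ⟨rfl, rfl⟩

theorem normTrace_of_size_eq_two (h : AnticommSqEq a.A a.B) (ha : a.size = 2) :
    a.normTrace [.X, .X] = -a.A.det ∧ a.normTrace [.X, .X, .X, .X] = (-a.A.det) ^ 2 := by
  refine normTrace_of_mul_self_eq_smul_one ?_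
  have htrace := h.trace_eq_zero
  obtain ⟨n, hn, A, B, hA, hB⟩ := a
  obtain rfl : n = 2 := ha
  exact mul_self_eq_neg_det_smul_one htrace

theorem eq_zero_of_size_eq_one (h : AnticommSqEq a.A a.B) (ha : a.size = 1) : a = zero := by
  have hA := h.trace_eq_zero
  have hB := h.symm.trace_eq_zero
  obtain ⟨n, hn, A, B, hA', hB'⟩ := a
  obtain rfl : n = 1 := ha
  rw [trace_fin_one] at hA hB
  obtain rfl : A = 0 := ext fun i j => by rwa [Subsingleton.elim i 0, Subsingleton.elim j 0]
  obtain rfl : B = 0 := ext fun i j => by rwa [Subsingleton.elim i 0, Subsingleton.elim j 0]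
  rfl

theorem zero_orthEquiv (h : AnticommSqEq a.A a.B) (ha : a.size = 1) : zero.OrthEquiv a := by
  rw [eq_zero_of_size_eq_one h ha]
  exact ⟨1, by simp, by simp, by simp, by simp⟩

theorem reflections_orthEquiv {r : ℝ} (hr : r ≠ 0) (h : AnticommSqEq a.A a.B)
    (ha : a.size = 2) (hdet : -a.A.det = r * r) : (reflections r).OrthEquiv a := by
  obtain ⟨n, hn, A, B, hA, hB⟩ := a
  obtain rfl : n = 2 := ha
  exact h.exists_orthogonal_conj hA hB hr hdet

end Atom

/-! ### Types and minimality -/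

namespace AtomicMeasure

section Types

variable {μ ν : AtomicMeasure} {m : List ℕ} {k : ℕ}

theorem size_le_maxSize (μ : AtomicMeasure) (i : Fin μ.N) : (μ.atom i).size ≤ μ.maxSize :=
  Finset.le_sup (f := fun i => (μ.atom i).size) (Finset.mem_univ i)

theorem numAtoms_eq_zero_iff : μ.numAtoms k = 0 ↔ ∀ i, (μ.atom i).size ≠ k := by
  simp [numAtoms, Finset.filter_eq_empty_iff]

theorem numAtoms_zero (μ : AtomicMeasure) : μ.numAtoms 0 = 0 :=
  numAtoms_eq_zero_iff.2 fun i => (μ.atom i).size_pos.ne'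

theorem numAtoms_eq_zero_of_maxSize_lt (h : μ.maxSize < k) : μ.numAtoms k = 0 :=
  numAtoms_eq_zero_iff.2 fun i => ((μ.size_le_maxSize i).trans_lt h).ne

theorem maxSize_of_type_eq (h : μ.type = m) : μ.maxSize = m.length := by
  rw [← h, type, List.length_map, List.length_range]

theorem numAtoms_succ_of_type_eq (h : μ.type = m) (hk : k < m.length) :
    μ.numAtoms (k + 1) = m[k] := by
  subst h
  simp [type]

theorem type_eq_of_numAtoms_eq (hmax : μ.maxSize = ν.maxSize)
    (h : ∀ k, μ.numAtoms k = ν.numAtoms k) : μ.type = ν.type := by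
  simp only [type, hmax, h]

theorem smaller_trichotomy (μ ν : AtomicMeasure) :
    μ.Smaller ν ∨ μ.type = ν.type ∨ ν.Smaller μ := by
  obtain hlt | hmax | hgt := lt_trichotomy μ.maxSize ν.maxSize
  · exact .inl (.inl hlt)
  · by_cases hnum : ∀ k, μ.numAtoms k = ν.numAtoms k
    · exact .inr (.inl (type_eq_of_numAtoms_eq hmax hnum))
    · have hbound {l} (hl : μ.numAtoms l ≠ ν.numAtoms l) : l ≤ μ.maxSize := by
        contrapose! hl
        rw [numAtoms_eq_zero_of_maxSize_lt hl, numAtoms_eq_zero_of_maxSize_lt (hmax ▸ hl)]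
      push Not at hnum
      obtain ⟨l, hl⟩ := hnum
      set k := Nat.findGreatest (fun l => μ.numAtoms l ≠ ν.numAtoms l) μ.maxSize
      have hk : μ.numAtoms k ≠ ν.numAtoms k :=
        Nat.findGreatest_spec (P := fun l => μ.numAtoms l ≠ ν.numAtoms l) (hbound hl) hl
      have hlast {l} (hkl : k < l) : μ.numAtoms l = ν.numAtoms l := by
        by_contra hl
        exact Nat.findGreatest_is_greatest hkl (hbound hl) hl
      obtain hlt | hgt := hk.lt_or_gt
      · exact .inl (.inr ⟨hmax, k, hlt, fun l hkl => hlast hkl⟩)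
      · exact .inr (.inr (.inr ⟨hmax.symm, k, hgt, fun l hkl => (hlast hkl).symm⟩))
  · exact .inr (.inr (.inl hgt))

theorem exists_equiv_of_type_eq_replicate {r : ℕ} (h : μ.type = List.replicate r 1) :
    ∃ e : Fin r ≃ Fin μ.N, ∀ k, (μ.atom (e k)).size = k + 1 := by
  have hmax : μ.maxSize = r := by rw [maxSize_of_type_eq h, List.length_replicate]
  have hunique (k : Fin r) : ∃ i, ∀ j, (μ.atom j).size = k + 1 ↔ j = i := by
    have hnum : μ.numAtoms (k + 1) = 1 := by
      rw [numAtoms_succ_of_type_eq h (by simp), List.getElem_replicate]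
    obtain ⟨i, hi⟩ := Finset.card_eq_one.1 hnum
    exact ⟨i, fun j => by simpa using Finset.ext_iff.1 hi j⟩
  choose f hf using hunique
  have hsize (k : Fin r) : (μ.atom (f k)).size = k + 1 := (hf k _).2 rfl
  refine ⟨.ofBijective f ⟨fun k l hkl => ?_, fun i => ?_⟩, hsize⟩
  · have : (k : ℕ) + 1 = l + 1 := by rw [← hsize k, ← hsize l, hkl]
    omega
  · have hpos := (μ.atom i).size_pos
    have hle := μ.size_le_maxSize i
    exact ⟨⟨(μ.atom i).size - 1, by omega⟩, ((hf _ i).1 (by simp only; omega)).symm⟩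

end Types

theorem represents_momentSeq (μ : AtomicMeasure) : μ.Represents μ.momentSeq :=
  fun _ => rfl

theorem normalized_momentSeq (μ : AtomicMeasure) : μ.momentSeq.Normalized := by
  change ∑ i, μ.density i * (μ.atom i).normTrace [] = 1
  simp only [Atom.normTrace_nil, mul_one, μ.density_sum]

end AtomicMeasure

/-! ### The canonical measure -/

/-- The measure of type `(1, 1)` with the atom `(0, 0)` of density `1 - l` and the atom
`Atom.reflections r` of density `l`: the normal form of the minimal representing measure. -/
noncomputable def canonicalMeasure (r l : ℝ) (h0 : 0 < l) (h1 : l < 1) : AtomicMeasure where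
  N := 2
  density := ![1 - l, l]
  density_pos := Fin.forall_fin_two.2 ⟨sub_pos.2 h1, h0⟩
  density_sum := by simp
  atom := ![Atom.zero, Atom.reflections r]

section canonicalMeasure

variable (r : ℝ) {l : ℝ} (h0 : 0 < l) (h1 : l < 1)

theorem type_canonicalMeasure : (canonicalMeasure r l h0 h1).type = [1, 1] := by
  have hmax : (canonicalMeasure r l h0 h1).maxSize = 2 := by
    rw [AtomicMeasure.maxSize, canonicalMeasure, Fin.univ_succ]
    simp [Atom.zero, Atom.reflections]
  have hnum (k : ℕ) : (canonicalMeasure r l h0 h1).numAtoms k =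
      (if 1 = k then 1 else 0) + (if 2 = k then 1 else 0) := by
    rw [AtomicMeasure.numAtoms, Finset.card_filter]
    exact Fin.sum_univ_two _
  simp [AtomicMeasure.type, hmax, hnum, List.range_succ]

theorem anticommSqEq_canonicalMeasure : ∀ i, AnticommSqEq
    ((canonicalMeasure r l h0 h1).atom i).A ((canonicalMeasure r l h0 h1).atom i).B :=
  Fin.forall_fin_two.2 ⟨.zero _, .reflections r⟩

theorem moment_momentSeq_canonicalMeasure (x : Letter) (w : List Letter)
    (hw : (x :: w).length ≤ 4) :
    (canonicalMeasure r l h0 h1).momentSeq.moment (x :: w) hw =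
      l * (Atom.reflections r).normTrace (x :: w) := by
  have hsum : (canonicalMeasure r l h0 h1).momentSeq.moment (x :: w) hw =
      (1 - l) * Atom.zero.normTrace (x :: w) + l * (Atom.reflections r).normTrace (x :: w) := by
    change ∑ i, (canonicalMeasure r l h0 h1).density i *
      ((canonicalMeasure r l h0 h1).atom i).normTrace (x :: w) = _
    exact Fin.sum_univ_two _
  rw [hsum, Atom.normTrace_zero_cons, mul_zero, zero_add]

theorem represents_canonicalMeasure {β : TracialSeq} (hβ : β.ColumnRelations)
    (hnorm : β.Normalized) (hX : β.moment [.X] = 0) (hY : β.moment [.Y] = 0)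
    (hXX : l * r ^ 2 = β.moment [.X, .X]) (hXXXX : l * r ^ 4 = β.moment [.X, .X, .X, .X]) :
    (canonicalMeasure r l h0 h1).Represents β := by
  set μ := canonicalMeasure r l h0 h1
  have hrel := AtomicMeasure.columnRelations_momentSeq (anticommSqEq_canonicalMeasure r h0 h1)
  have hmoment := (Atom.reflections r).normTrace_of_size_eq_two (.reflections r) rfl
  have hdet : -(Atom.reflections r).A.det = r ^ 2 := by
    change -(!![r, 0; 0, -r]).det = r ^ 2
    rw [det_fin_two_of]
    ring
  rw [hdet] at hmoment
  refine hβ.val_eq_val hrel (hnorm.trans μ.normalized_momentSeq.symm) ?_ ?_ ?_ ?_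
  · exact hX.trans (μ.represents_momentSeq.moment_singleton_eq_zero hrel .X).symm
  · exact hY.trans (μ.represents_momentSeq.moment_singleton_eq_zero hrel .Y).symm
  · rw [moment_momentSeq_canonicalMeasure, hmoment.1, hXX]
  · rw [moment_momentSeq_canonicalMeasure, hmoment.2, ← hXXXX, ← pow_mul]

end canonicalMeasure

namespace AtomicMeasure

variable {β : TracialSeq} {μ ν : AtomicMeasure}

namespace Represents

theorem exists_one_lt_size (hν : ν.Represents β) (hβ : β.ColumnRelations)
    (hXXXX : β.moment [.X, .X, .X, .X] ≠ 0) : ∃ i, 1 < (ν.atom i).size := by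
  by_contra! hle
  refine hXXXX ((hν _).trans (Finset.sum_eq_zero fun i _ => ?_))
  have hsize : (ν.atom i).size = 1 := (hle i).antisymm (ν.atom i).size_pos
  rw [Atom.eq_zero_of_size_eq_one (hν.anticommSqEq hβ i) hsize, Atom.normTrace_zero_cons,
    mul_zero]

theorem numAtoms_one_ne_zero (hν : ν.Represents β) (hβ : β.ColumnRelations)
    (hne : β.moment [.X, .X] ^ 2 ≠ β.moment [.X, .X, .X, .X]) (hmax : ν.maxSize = 2)
    (htwo : ν.numAtoms 2 = 1) : ν.numAtoms 1 ≠ 0 := by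
  intro hone
  have hsize (i : Fin ν.N) : (ν.atom i).size = 2 := by
    have hpos := (ν.atom i).size_pos
    have hle := ν.size_le_maxSize i
    have hne_one := numAtoms_eq_zero_iff.1 hone i
    omega
  have hN : ν.N = 1 := by
    rwa [numAtoms, Finset.filter_true_of_mem fun i _ => hsize i, Finset.card_fin] at htwo
  have : Unique (Fin ν.N) := hN ▸ inferInstance
  have hmoment (w : List Letter) (hw : w.length ≤ 4) :
      β.moment w hw = (ν.atom default).normTrace w := by
    have hdensity := ν.density_sum
    rw [Fintype.sum_unique] at hdensity
    rw [TracialSeq.moment, hν, Fintype.sum_unique, hdensity, one_mul]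
  obtain ⟨hXX, hXXXX⟩ :=
    (ν.atom default).normTrace_of_size_eq_two (hν.anticommSqEq hβ default) (hsize default)
  rw [hmoment, hmoment, hXX, hXXXX] at hne
  exact hne rfl

theorem not_smaller (hν : ν.Represents β) (hβ : β.ColumnRelations)
    (hlt : β.moment [.X, .X] ^ 2 < β.moment [.X, .X, .X, .X]) (hμ : μ.type = [1, 1]) :
    ¬ ν.Smaller μ := by
  have hmaxμ : μ.maxSize = 2 := maxSize_of_type_eq hμ
  have hμ1 : μ.numAtoms 1 = 1 := numAtoms_succ_of_type_eq hμ (k := 0) two_pos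
  have hμ2 : μ.numAtoms 2 = 1 := numAtoms_succ_of_type_eq hμ (k := 1) one_lt_two
  obtain ⟨i, hi⟩ := hν.exists_one_lt_size hβ ((sq_nonneg _).trans_lt hlt).ne'
  have hle := ν.size_le_maxSize i
  rintro (hmax | ⟨hmax, k, hk, hagree⟩)
  · omega
  have hk2 : k ≤ 2 := by
    by_contra! hgt
    rw [numAtoms_eq_zero_of_maxSize_lt (μ := μ) (hmaxμ.trans_lt hgt)] at hk
    exact Nat.not_lt_zero _ hk
  interval_cases k
  · simp only [numAtoms_zero, lt_irrefl] at hk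
  · have hν1 := hν.numAtoms_one_ne_zero hβ hlt.ne (hmax.trans hmaxμ)
      ((hagree 2 one_lt_two).trans hμ2)
    omega
  · have hν2 : ν.numAtoms 2 = 0 := by omega
    exact numAtoms_eq_zero_iff.1 hν2 i (by omega)

theorem isMinimal_of_type_eq (hμ : μ.Represents β) (htype : μ.type = [1, 1])
    (hβ : β.ColumnRelations) (hlt : β.moment [.X, .X] ^ 2 < β.moment [.X, .X, .X, .X]) :
    μ.IsMinimal β :=
  ⟨hμ, fun ⟨_, hν, hsmaller⟩ => hν.not_smaller hβ hlt htype hsmaller⟩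

end Represents

theorem IsMinimal.type_eq (hν : ν.IsMinimal β) (hμ : μ.IsMinimal β) : ν.type = μ.type :=
  ((smaller_trichotomy ν μ).resolve_left fun h => hμ.2 ⟨ν, hν.1, h⟩).resolve_right
    fun h => hν.2 ⟨μ, hμ.1, h⟩

end AtomicMeasure

theorem canonicalMeasure_orthEquiv {β : TracialSeq} {ν : AtomicMeasure} {r l : ℝ} (h0 : 0 < l)
    (h1 : l < 1) (hr : r ≠ 0) (hν : ν.Represents β) (hβ : β.ColumnRelations)
    (htype : ν.type = [1, 1]) (hXX : l * r ^ 2 = β.moment [.X, .X])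
    (hXXXX : l * r ^ 4 = β.moment [.X, .X, .X, .X]) :
    (canonicalMeasure r l h0 h1).OrthEquiv ν := by
  obtain ⟨e, he⟩ := AtomicMeasure.exists_equiv_of_type_eq_replicate (r := 2) htype
  have hrel (k : Fin 2) := hν.anticommSqEq hβ (e k)
  have hdensity : ν.density (e 0) + ν.density (e 1) = 1 := by
    rw [← ν.density_sum, ← e.sum_comp, Fin.sum_univ_two]
  have hmoment (x : Letter) (w : List Letter) (hw : (x :: w).length ≤ 4) :
      β.moment (x :: w) hw = ν.density (e 1) * (ν.atom (e 1)).normTrace (x :: w) := by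
    rw [TracialSeq.moment, hν, ← e.sum_comp, Fin.sum_univ_two,
      Atom.eq_zero_of_size_eq_one (hrel 0) (he 0), Atom.normTrace_zero_cons, mul_zero, zero_add]
  obtain ⟨hs, hs'⟩ := Atom.normTrace_of_size_eq_two (hrel 1) (he 1)
  rw [hmoment, hs] at hXX
  rw [hmoment, hs'] at hXXXX
  have hdet : -(ν.atom (e 1)).A.det = r ^ 2 := by
    refine mul_left_cancel₀ (mul_ne_zero h0.ne' (pow_ne_zero 2 hr)) ?_
    linear_combination -(ν.atom (e 1)).A.det * hXX - hXXXX
  have hl : l = ν.density (e 1) :=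
    mul_right_cancel₀ (pow_ne_zero 2 hr) (hXX.trans (by rw [hdet]))
  refine ⟨e, Fin.forall_fin_two.2 ⟨⟨?_, ?_⟩, hl.symm, ?_⟩⟩
  · exact (eq_sub_of_add_eq hdensity).trans (by rw [← hl]; rfl)
  · exact Atom.zero_orthEquiv (hrel 0) (he 0)
  · exact Atom.reflections_orthEquiv hr (hrel 1) (he 1) (hdet.trans (sq r))

theorem exists_mul_sq_eq_mul_pow_four_eq {a c : ℝ} (ha : 0 < a) (hac : a ^ 2 < c) :
    ∃ r l : ℝ, r ≠ 0 ∧ 0 < l ∧ l < 1 ∧ l * r ^ 2 = a ∧ l * r ^ 4 = c := by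
  have hc : 0 < c := (pow_pos ha 2).trans hac
  have hr : √(c / a) ^ 2 = c / a := Real.sq_sqrt (div_pos hc ha).le
  refine ⟨√(c / a), a ^ 2 / c, (Real.sqrt_pos.2 (div_pos hc ha)).ne', by positivity,
    (div_lt_one hc).2 hac, ?_, ?_⟩
  · rw [hr]
    field_simp
  · rw [show 4 = 2 * 2 from rfl, pow_mul, hr]
    field_simp

theorem TracialSeq.ColumnRelations.exists_isMinimal {β : TracialSeq} (hβ : β.ColumnRelations)
    (hnorm : β.Normalized) (hX : β.moment [.X] = 0) (hY : β.moment [.Y] = 0)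
    (hpos : 0 < β.moment [.X, .X])
    (hlt : β.moment [.X, .X] ^ 2 < β.moment [.X, .X, .X, .X]) :
    ∃ μ : AtomicMeasure, μ.IsMinimal β ∧ μ.type = [1, 1] ∧
      ∀ ν : AtomicMeasure, ν.IsMinimal β → μ.OrthEquiv ν := by
  obtain ⟨r, l, hr, h0, h1, hXX, hXXXX⟩ := exists_mul_sq_eq_mul_pow_four_eq hpos hlt
  have htype := type_canonicalMeasure r h0 h1
  have hmin := (represents_canonicalMeasure r h0 h1 hβ hnorm hX hY hXX hXXXX).isMinimal_of_type_eq
    htype hβ hlt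
  exact ⟨_, hmin, htype, fun ν hν =>
    canonicalMeasure_orthEquiv h0 h1 hr hν.1 hβ ((hν.type_eq hmin).trans htype) hXX hXXXX⟩

end BQTMP

theorem theorem6p13 (β : BQTMP.TracialSeq) (hnorm : β.Normalized) (hnc : β.Noncommutative)
    (hrank : β.momentMatrix.rank = 5)
    (hXY : β.column [.X, .Y] + β.column [.Y, .X] = 0)
    (hXX : β.column [.X, .X] = β.column [.Y, .Y]) :
    (β.AdmitsNcMeasure ↔
      β.momentMatrix.PosSemidef ∧ β.moment [.X] = 0 ∧ β.moment [.Y] = 0) ∧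
    (β.AdmitsNcMeasure →
      ∃ μ : BQTMP.AtomicMeasure, μ.IsMinimal β ∧ μ.type = [1, 1] ∧
        ∀ ν : BQTMP.AtomicMeasure, ν.IsMinimal β → μ.OrthEquiv ν) := by
  have hβ : β.ColumnRelations := ⟨hXY, hXX⟩
  have necessary : β.AdmitsNcMeasure →
      β.momentMatrix.PosSemidef ∧ β.moment [.X] = 0 ∧ β.moment [.Y] = 0 := fun ⟨_, hμ, _⟩ =>
    ⟨hμ.1.posSemidef, hμ.1.moment_singleton_eq_zero hβ .X, hμ.1.moment_singleton_eq_zero hβ .Y⟩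
  have sufficient : β.momentMatrix.PosSemidef ∧ β.moment [.X] = 0 ∧ β.moment [.Y] = 0 →
      ∃ μ : BQTMP.AtomicMeasure, μ.IsMinimal β ∧ μ.type = [1, 1] ∧
        ∀ ν : BQTMP.AtomicMeasure, ν.IsMinimal β → μ.OrthEquiv ν := fun ⟨hpsd, hX, hY⟩ =>
    hβ.exists_isMinimal hnorm hX hY (hβ.moment_XX_pos hrank hpsd)
      (hβ.sq_moment_XX_lt hnorm hrank hpsd)
  refine ⟨⟨necessary, fun h => ?_⟩, fun h => sufficient (necessary h)⟩
  obtain ⟨μ, hμ, htype, -⟩ := sufficient h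
  exact ⟨μ, hμ, one_lt_two.trans_eq (BQTMP.AtomicMeasure.maxSize_of_type_eq htype).symm⟩
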